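/- **Proposition 5.2 (Hopf's Lemma in $\mathbb{R}^N$).** Let $N\in\mathbb{N}$ and $p\in\mathbb{R}$ with $1<p<N$, let $A,r,\alpha>0$, and let $B_r=\{x\in\mathbb{R}^N:|x|<r\}$. Let $$u\in D^{1,p}(\mathbb{R}^N)\cap C^{1,\alpha}_{\mathrm{loc}}(\mathbb{R}^N),$$ where $D^{1,p}(\mathbb{R}^N)=\{u\in L^{p^*}(\mathbb{R}^N):\nabla u\in L^p(\mathbb{R}^N,\mathbb{R}^N)\}$ (weak gradient), $p^*=\frac{Np}{N-p}$, and $C^{1,\alpha}_{\mathrm{loc}}(\mathbb{R}^N)$ is the set of $C^1$ functions whose gradient is $\alpha$-Hölder continuous on every compact set. Suppose that $u\ge 0$ in $\mathbb{R}^N$, that $-\Delta_p u\ge A$ weakly in $B_r$ and that $-\Delta_p u\ge 0$ weakly in $\mathbb{R}^N$, i.e. $$\int_{B_r}|\nabla u|^{p-2}\nabla u\cdot\nabla\varphi\,dx\ \ge\ A\int_{B_r}\varphi\,dx\quad\text{for all }0\le\varphi\in C_c^\infty(B_r),$$ $$\int_{\mathbb{R}^N}|\nabla u|^{p-2}\nabla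 u\cdot\nabla\varphi\,dx\ \ge\ 0\quad\text{for all }0\le\varphi\in C_c^\infty(\mathbb{R}^N).$$ Then $$u(x)\ \ge\ C\,|x|^{\frac{p-N}{p-1}}\quad\text{for all }|x|>r,\qquad\text{where}\quad C=\left(\frac{A}{N}\right)^{\frac1{p-1}}\frac{p-1}{N-p}\,r^{\frac{N}{p-1}} .$$ -/

import Mathlib

open MeasureTheory
open scoped NNReal ENNReal ContDiff

/-- Test functions on `Ω ⊆ ℝ^N`: smooth real functions with compact support contained in `Ω`. -/
def IsTestFunction {N : ℕ} (Ω : Set (EuclideanSpace ℝ (Fin N)))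
    (φ : EuclideanSpace ℝ (Fin N) → ℝ) : Prop :=
  ContDiff ℝ ∞ φ ∧ HasCompactSupport φ ∧ tsupport φ ⊆ Ω

/-- `G` is a weak (distributional) gradient of `u` on `ℝ^N`:
`∫ u ∇φ dx = - ∫ φ G dx` for all `φ ∈ C_c^∞(ℝ^N)`. -/
def HasWeakGradient {N : ℕ} (u : EuclideanSpace ℝ (Fin N) → ℝ)
    (G : EuclideanSpace ℝ (Fin N) → EuclideanSpace ℝ (Fin N)) : Prop :=
  LocallyIntegrable u ∧ LocallyIntegrable G ∧
    ∀ φ : EuclideanSpace ℝ (Fin N) → ℝ, IsTestFunction Set.univ φ →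
      ∫ x, u x • gradient φ x = - ∫ x, φ x • G x

/-- The space `D^{1,p}(ℝ^N)` for `1 < p < N`: functions in `L^{p*}(ℝ^N)`, where `p* = Np/(N-p)`,
whose weak gradient lies in `L^p(ℝ^N, ℝ^N)`. -/
def MemD1p {N : ℕ} (p : ℝ) (u : EuclideanSpace ℝ (Fin N) → ℝ) : Prop :=
  MemLp u (ENNReal.ofReal (N * p / (N - p))) ∧
    ∃ G : EuclideanSpace ℝ (Fin N) → EuclideanSpace ℝ (Fin N),
      HasWeakGradient u G ∧ MemLp G (ENNReal.ofReal p)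

/-- The space `C^{1,α}_loc(ℝ^N)`: continuously differentiable functions whose gradient is
`α`-Hölder continuous on every compact set. -/
def MemC1HolderLoc {N : ℕ} (α : ℝ≥0) (u : EuclideanSpace ℝ (Fin N) → ℝ) : Prop :=
  ContDiff ℝ 1 u ∧
    ∀ K : Set (EuclideanSpace ℝ (Fin N)), IsCompact K →
      ∃ C : ℝ≥0, HolderOnWith C α (gradient u) K

/-- For a `C^1` function `u`, an exponent `p > 1`, a constant `c` and an open set `Ω`:
the inequality `-Δ_p u ≥ c` holds weakly in `Ω`, that is,
`∫_Ω |∇u|^{p-2} ∇u · ∇φ dx ≥ ∫_Ω c φ dx` for all nonnegative `φ ∈ C_c^∞(Ω)`.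
(Where `∇u = 0` the vector `|∇u|^{p-2} ∇u` is `0`, also in Lean and also for `p < 2`.) -/
def WeakNegPLaplacianGE {N : ℕ} (p : ℝ) (Ω : Set (EuclideanSpace ℝ (Fin N)))
    (u : EuclideanSpace ℝ (Fin N) → ℝ) (c : ℝ) : Prop :=
  ∀ φ : EuclideanSpace ℝ (Fin N) → ℝ, IsTestFunction Ω φ → (∀ x, 0 ≤ φ x) →
    ∫ x in Ω, c * φ x ≤
      ∫ x in Ω, ‖gradient u x‖ ^ (p - 2) * inner ℝ (gradient u x) (gradient φ x)

/-! The lower bound is the exterior part of an explicit radial barrier `v` that solves `-Δ_p v = A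
1_{|x| < r}` on the whole space and tends to zero at infinity (`exists_radial_barrier`); outside the
ball it equals `C |x|^((p-N)/(p-1))`. A partition of unity merges the two hypotheses into `-Δ_p u ≥
A 1_{|x| < r}` (`weakNegPLaplacianGE_glue`), so `u` is a supersolution of the barrier's equation.

Since `u ≥ 0` and `v → 0`, for every `ε > 0` the function `((v - u - ε)⁺)²` has compact support.
Testing both relations with it, strict monotonicity of `a ↦ |a|^(p-2) a` forces its gradient to
vanish, hence it is zero (`le_of_weak_pLaplacian_le`). The square makes the test function `C^1`,
which avoids Sobolev spaces; mollification (`weak_ineq_of_smooth`) admits such tests. That `v`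
solves its equation weakly is a divergence identity, checked ray by ray in polar coordinates
(`integral_fderiv_truncated_radial`). -/

/-! ### The vector field of the `p`-Laplacian and its monotonicity. -/

section MonotoneField

variable {E : Type*} [NormedAddCommGroup E] [InnerProductSpace ℝ E]

/-- The vector field `a ↦ |a|^{p-2} a` of the `p`-Laplacian. -/
noncomputable def pField (p : ℝ) (a : E) : E := ‖a‖ ^ (p - 2) • a

theorem rpow_sub_two_mul_self {p x : ℝ} (hp : 1 < p) (hx : 0 ≤ x) :
    x ^ (p - 2) * x = x ^ (p - 1) := by
  rcases hx.eq_or_lt with rfl | hx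
  · rw [mul_zero, Real.zero_rpow (by linarith)]
  · rw [← Real.rpow_add_one hx.ne']
    ring_nf

theorem norm_pField {p : ℝ} (hp : 1 < p) (a : E) : ‖pField p a‖ = ‖a‖ ^ (p - 1) := by
  rw [pField, norm_smul, Real.norm_of_nonneg (by positivity),
    rpow_sub_two_mul_self hp (norm_nonneg a)]

/-- Only the origin is delicate: for `p < 2` the scalar factor blows up there, but the norm of the
field is `‖a‖ ^ (p - 1)`, which tends to zero. -/
theorem continuous_pField {p : ℝ} (hp : 1 < p) : Continuous (pField p : E → E) := by
  rw [continuous_iff_continuousAt]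
  intro a
  rcases eq_or_ne a 0 with rfl | ha
  · have h : Filter.Tendsto (fun b : E => ‖b‖ ^ (p - 1)) (nhds 0) (nhds 0) := by
      have : Continuous fun b : E => ‖b‖ ^ (p - 1) :=
        continuous_norm.rpow_const fun _ => Or.inr (by linarith)
      simpa [Real.zero_rpow (show p - 1 ≠ 0 by linarith)] using this.tendsto 0
    rw [ContinuousAt, show pField p (0 : E) = 0 by simp [pField], tendsto_zero_iff_norm_tendsto_zero]
    simpa only [norm_pField hp] using h
  · exact (continuousAt_id.norm.rpow_const (Or.inl (by simpa using ha))).smul continuousAt_id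

/-- If the norms agree, the product is `‖b‖ ^ (p - 2) * ‖a - b‖ ^ 2`. Otherwise Cauchy–Schwarz
bounds it below by `(‖a‖ ^ (p - 1) - ‖b‖ ^ (p - 1)) * (‖a‖ - ‖b‖)`, positive because `t ↦ t ^ (p -
1)` is strictly increasing. -/
theorem inner_pField_sub_pos {p : ℝ} (hp : 1 < p) {a b : E} (hab : a ≠ b) :
    0 < inner ℝ (pField p a - pField p b) (a - b) := by
  have hs := rpow_sub_two_mul_self hp (norm_nonneg a)
  have ht := rpow_sub_two_mul_self hp (norm_nonneg b)
  have hi := real_inner_le_norm a b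
  have hsub : 0 < ‖a - b‖ ^ 2 := by
    have := norm_pos_iff.2 (sub_ne_zero.2 hab)
    positivity
  rw [norm_sub_sq_real] at hsub
  have hs0 : 0 ≤ ‖a‖ ^ (p - 2) := by positivity
  have ht0 : 0 ≤ ‖b‖ ^ (p - 2) := by positivity
  have hexp : inner ℝ (pField p a - pField p b) (a - b) =
      ‖a‖ ^ (p - 2) * ‖a‖ ^ 2 + ‖b‖ ^ (p - 2) * ‖b‖ ^ 2
        - (‖a‖ ^ (p - 2) + ‖b‖ ^ (p - 2)) * inner ℝ a b := by
    simp only [pField, inner_sub_left, inner_sub_right, real_inner_smul_left,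
      real_inner_self_eq_norm_sq, real_inner_comm a b]
    ring
  rw [hexp]
  rcases eq_or_ne ‖a‖ ‖b‖ with h | h
  · have hb : 0 < ‖b‖ := by
      rcases (norm_nonneg b).eq_or_lt with h0 | h0
      · rw [h, ← h0] at hsub hi
        have : a = 0 := norm_eq_zero.1 (h.trans h0.symm)
        simp [this] at hsub
      · exact h0
    rw [h] at hsub ⊢
    have : 0 < ‖b‖ ^ (p - 2) := Real.rpow_pos_of_pos hb _
    nlinarith
  · have hprod : 0 < (‖a‖ ^ (p - 1) - ‖b‖ ^ (p - 1)) * (‖a‖ - ‖b‖) := by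
      rcases lt_or_gt_of_ne h with h | h
      · have := Real.rpow_lt_rpow (norm_nonneg a) h (show 0 < p - 1 by linarith)
        exact mul_pos_of_neg_of_neg (by linarith) (by linarith)
      · have := Real.rpow_lt_rpow (norm_nonneg b) h (show 0 < p - 1 by linarith)
        exact mul_pos (by linarith) (by linarith)
    rw [← hs, ← ht] at hprod
    nlinarith [mul_le_mul_of_nonneg_left hi (add_nonneg hs0 ht0)]

end MonotoneField

/-! ### Gradients and integrability against compactly supported tests. -/

section Gradient

variable {E : Type*} [NormedAddCommGroup E] [InnerProductSpace ℝ E] [CompleteSpace E]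

theorem inner_gradient (f : E → ℝ) (x y : E) : inner ℝ (gradient f x) y = fderiv ℝ f x y := by
  rw [gradient, InnerProductSpace.toDual_symm_apply]

theorem ContDiff.continuous_gradient {f : E → ℝ} (hf : ContDiff ℝ 1 f) :
    Continuous (gradient f) :=
  (InnerProductSpace.toDual ℝ E).symm.continuous.comp (hf.continuous_fderiv one_ne_zero)

theorem gradient_eq_zero_of_notMem_tsupport {f : E → ℝ} {x : E} (hx : x ∉ tsupport f) :
    gradient f x = 0 := by
  have : fderiv ℝ f x = 0 := by
    by_contra h
    exact hx (support_fderiv_subset ℝ h)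
  rw [gradient, this, map_zero]

theorem integrable_inner_gradient [MeasurableSpace E] [BorelSpace E]
    {μ : Measure E} [IsFiniteMeasureOnCompacts μ] {F : E → E} (hF : Continuous F)
    {φ : E → ℝ} (hφ : ContDiff ℝ 1 φ) (hc : HasCompactSupport φ) :
    Integrable (fun x => inner ℝ (F x) (gradient φ x)) μ :=
  (hF.inner hφ.continuous_gradient).integrable_of_hasCompactSupport
    (HasCompactSupport.intro hc fun x hx => by
      simp [gradient_eq_zero_of_notMem_tsupport hx])

end Gradient

/-! ### From smooth to `C^1` test functions. -/

section Mollify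

variable {E : Type*} [NormedAddCommGroup E] [InnerProductSpace ℝ E] [FiniteDimensional ℝ E]

/-- A nonnegative compactly supported `C^1` function is approximated in `C^1` by nonnegative
smooth functions supported in a fixed neighbourhood of its support. -/
theorem exists_smooth_C1_approx {φ : E → ℝ} (hφ : ContDiff ℝ 1 φ) (hc : HasCompactSupport φ)
    (h0 : ∀ x, 0 ≤ φ x) {δ : ℝ} (hδ : 0 < δ) :
    ∃ ψ : E → ℝ, ContDiff ℝ ∞ ψ ∧ tsupport ψ ⊆ Metric.cthickening 1 (tsupport φ) ∧
      (∀ x, 0 ≤ ψ x) ∧ ∀ x, |ψ x - φ x| ≤ δ ∧ ‖gradient ψ x - gradient φ x‖ ≤ δ := by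
  borelize E
  let μ : Measure E := Measure.addHaar
  have hu := hφ.continuous.uniformContinuous_of_tendsto_cocompact hc.is_zero_at_infty
  have hgc : HasCompactSupport (fderiv ℝ φ) := hc.fderiv ℝ
  have hgcont := hφ.continuous_fderiv one_ne_zero
  have hgu := hgcont.uniformContinuous_of_tendsto_cocompact hgc.is_zero_at_infty
  obtain ⟨d₁, hd₁, h₁⟩ := Metric.uniformContinuous_iff.1 hu δ hδ
  obtain ⟨d₂, hd₂, h₂⟩ := Metric.uniformContinuous_iff.1 hgu δ hδ
  -- The mollification radius: `1` controls the support, `d₁` the values and `d₂` the derivatives.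
  set d := min 1 (min d₁ d₂) with hd
  have hd0 : 0 < d := by positivity
  let η : ContDiffBump (0 : E) := ⟨d / 2, d, half_pos hd0, half_lt_self hd0⟩
  have hηl : LocallyIntegrable (η.normed μ) μ := η.continuous_normed.locallyIntegrable
  let ψ : E → ℝ := MeasureTheory.convolution (η.normed μ) φ (ContinuousLinearMap.lsmul ℝ ℝ) μ
  have hfd : ∀ x, fderiv ℝ ψ x = MeasureTheory.convolution (η.normed μ) (fderiv ℝ φ)
      (ContinuousLinearMap.lsmul ℝ ℝ) μ x := fun x =>
    (hc.hasFDerivAt_convolution_right (ContinuousLinearMap.lsmul ℝ ℝ) hηl hφ x).fderiv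
  refine ⟨ψ, ?_, ?_, ?_, fun x => ⟨?_, ?_⟩⟩
  · exact η.hasCompactSupport_normed.contDiff_convolution_left _ η.contDiff_normed
      hφ.continuous.locallyIntegrable
  · refine closure_minimal (fun x hx => ?_) Metric.isClosed_cthickening
    obtain ⟨y, hy, z, hz, rfl⟩ := support_convolution_subset_swap _ hx
    rw [η.support_normed_eq] at hz
    refine Metric.mem_cthickening_of_dist_le _ y _ _ (subset_tsupport _ hy) ?_
    have : ‖z‖ < d := by simpa using hz
    simpa using this.le.trans (min_le_left _ _)
  · intro x
    exact integral_nonneg fun y => mul_nonneg (η.nonneg_normed y) (h0 _)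
  · refine η.dist_normed_convolution_le hφ.continuous.aestronglyMeasurable fun y hy => (h₁ ?_).le
    exact lt_of_lt_of_le hy ((min_le_right _ _).trans (min_le_left _ _))
  · rw [gradient, gradient, ← map_sub, LinearIsometryEquiv.norm_map, ← dist_eq_norm, hfd]
    refine η.dist_normed_convolution_le hgcont.aestronglyMeasurable fun y hy => (h₂ ?_).le
    exact lt_of_lt_of_le hy ((min_le_right _ _).trans (min_le_right _ _))

/-- A weak differential inequality tested by smooth functions also holds for `C^1` tests. -/
theorem weak_ineq_of_smooth [MeasurableSpace E] [BorelSpace E]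
    {μ : Measure E} [IsFiniteMeasureOnCompacts μ] {F : E → E} (hF : Continuous F)
    {A r : ℝ} (hA : 0 ≤ A)
    (h : ∀ ψ : E → ℝ, ContDiff ℝ ∞ ψ → HasCompactSupport ψ → (∀ x, 0 ≤ ψ x) →
      A * ∫ x in Metric.ball 0 r, ψ x ∂μ ≤ ∫ x, inner ℝ (F x) (gradient ψ x) ∂μ)
    {φ : E → ℝ} (hφ : ContDiff ℝ 1 φ) (hc : HasCompactSupport φ) (h0 : ∀ x, 0 ≤ φ x) :
    A * ∫ x in Metric.ball 0 r, φ x ∂μ ≤ ∫ x, inner ℝ (F x) (gradient φ x) ∂μ := by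
  have hK : IsCompact (Metric.cthickening 1 (tsupport φ)) := IsCompact.cthickening hc
  set K := Metric.cthickening 1 (tsupport φ)
  have hKm : MeasurableSet K := hK.isClosed.measurableSet
  have hFK : IntegrableOn (fun x => ‖F x‖) K μ := hF.norm.continuousOn.integrableOn_compact hK
  have hφK : ∀ x, x ∉ K → gradient φ x = 0 := fun x hx =>
    gradient_eq_zero_of_notMem_tsupport fun h => hx (Metric.self_subset_cthickening _ h)
  -- A `C^1` error `δ` in the test function costs at most `δ * M` over both sides.
  set M := A * μ.real (Metric.ball 0 r) + ∫ x in K, ‖F x‖ ∂μ with hM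
  have hball : μ (Metric.ball 0 r) < ⊤ := measure_ball_lt_top
  have key : ∀ δ, 0 < δ → A * ∫ x in Metric.ball 0 r, φ x ∂μ ≤
      ∫ x, inner ℝ (F x) (gradient φ x) ∂μ + δ * M := by
    intro δ hδ
    obtain ⟨ψ, hψ, hψK, hψ0, hψδ⟩ := exists_smooth_C1_approx hφ hc h0 hδ
    have hψc : HasCompactSupport ψ := hK.of_isClosed_subset (isClosed_tsupport _) hψK
    have hψ1 : ContDiff ℝ 1 ψ := hψ.of_le (by exact_mod_cast le_top)
    have hl : ∫ x in Metric.ball 0 r, φ x ∂μ ≤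
        ∫ x in Metric.ball 0 r, ψ x ∂μ + δ * μ.real (Metric.ball 0 r) := by
      have hi : IntegrableOn (fun _ : E => δ) (Metric.ball 0 r) μ := integrableOn_const hball.ne
      have hψi : IntegrableOn ψ (Metric.ball 0 r) μ :=
        (hψ.continuous.integrable_of_hasCompactSupport hψc).integrableOn
      calc _ ≤ ∫ x in Metric.ball 0 r, (ψ x + δ) ∂μ := by
            refine setIntegral_mono (hφ.continuous.integrable_of_hasCompactSupport hc).integrableOn
              (hψi.add hi) fun x => ?_
            have := (abs_le.1 (hψδ x).1).1
            simp only [] at this ⊢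
            linarith
        _ = _ := by
            rw [integral_add hψi hi, setIntegral_const, smul_eq_mul, mul_comm δ]
    have hr : ∫ x, inner ℝ (F x) (gradient ψ x) ∂μ ≤
        ∫ x, inner ℝ (F x) (gradient φ x) ∂μ + δ * ∫ x in K, ‖F x‖ ∂μ := by
      have hi : Integrable (K.indicator fun x => δ * ‖F x‖) μ :=
        (integrable_indicator_iff hKm).2 (hFK.const_mul δ)
      have hφi := integrable_inner_gradient (μ := μ) hF hφ hc
      calc _ ≤ ∫ x, (inner ℝ (F x) (gradient φ x) + K.indicator (fun x => δ * ‖F x‖) x) ∂μ := by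
            refine integral_mono (integrable_inner_gradient hF hψ1 hψc) (hφi.add hi) fun x => ?_
            by_cases hx : x ∈ K
            · have h1 := real_inner_le_norm (F x) (gradient ψ x - gradient φ x)
              have h2 := mul_le_mul_of_nonneg_left (hψδ x).2 (norm_nonneg (F x))
              rw [inner_sub_right] at h1
              simp only [Set.indicator_of_mem hx]
              linarith
            · simp [Set.indicator_of_notMem hx, hφK x hx,
                gradient_eq_zero_of_notMem_tsupport fun h => hx (hψK h)]
        _ = _ := by
            rw [integral_add hφi hi, integral_indicator hKm, integral_const_mul]
    have := h ψ hψ hψc hψ0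
    have h3 := mul_le_mul_of_nonneg_left hl hA
    rw [hM]
    linarith
  have hM0 : 0 ≤ M := by
    have : 0 ≤ ∫ x in K, ‖F x‖ ∂μ := integral_nonneg fun _ => norm_nonneg _
    positivity
  refine le_of_forall_pos_le_add fun ε hε => ?_
  have h1 := key (ε / (M + 1)) (by positivity)
  have h2 : ε / (M + 1) * M ≤ ε := by
    rw [div_mul_eq_mul_div, div_le_iff₀ (by positivity)]
    nlinarith
  linarith

end Mollify

/-! ### Merging the local and the global inequality. -/

section Gluing

variable {N : ℕ}

theorem inner_pField_gradient (p : ℝ) (u φ : EuclideanSpace ℝ (Fin N) → ℝ)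
    (x : EuclideanSpace ℝ (Fin N)) :
    inner ℝ (pField p (gradient u x)) (gradient φ x) =
      ‖gradient u x‖ ^ (p - 2) * inner ℝ (gradient u x) (gradient φ x) := by
  rw [pField, real_inner_smul_left]

/-- If `-Δ_p u ≥ A` in a ball and `-Δ_p u ≥ 0` everywhere, then `-Δ_p u ≥ A 1_B` everywhere. -/
theorem weakNegPLaplacianGE_glue {p A r : ℝ} (hp : 1 < p) (hA : 0 ≤ A) (hr : 0 < r)
    {u : EuclideanSpace ℝ (Fin N) → ℝ} (hu : ContDiff ℝ 1 u)
    (hball : WeakNegPLaplacianGE p (Metric.ball 0 r) u A)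
    (hglobal : WeakNegPLaplacianGE p Set.univ u 0)
    {φ : EuclideanSpace ℝ (Fin N) → ℝ} (hφ : ContDiff ℝ ∞ φ) (hc : HasCompactSupport φ)
    (h0 : ∀ x, 0 ≤ φ x) :
    A * ∫ x in Metric.ball 0 r, φ x ≤ ∫ x, inner ℝ (pField p (gradient u x)) (gradient φ x) := by
  have hF : Continuous fun x => pField p (gradient u x) :=
    (continuous_pField hp).comp hu.continuous_gradient
  have hle : (1 : WithTop ℕ∞) ≤ ((⊤ : ℕ∞) : WithTop ℕ∞) := by exact_mod_cast le_top
  have hφi := hφ.continuous.integrable_of_hasCompactSupport (μ := volume) hc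
  have key : ∀ ρ, 0 < ρ → ρ < r → A * ∫ x in Metric.closedBall 0 ρ, φ x ≤
      ∫ x, inner ℝ (pField p (gradient u x)) (gradient φ x) := by
    intro ρ hρ hρr
    -- Split `φ = η φ + (1 - η) φ`: the first piece tests the inequality in the ball, the second the
    -- global one.
    let η : ContDiffBump (0 : EuclideanSpace ℝ (Fin N)) :=
      ⟨ρ, (ρ + r) / 2, hρ, by linarith⟩
    have hηφ : ContDiff ℝ ∞ fun x => η x * φ x := η.contDiff.mul hφ
    have hηφc : HasCompactSupport fun x => η x * φ x := hc.mul_left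
    have hηφs : tsupport (fun x => η x * φ x) ⊆ Metric.ball 0 r := by
      refine (tsupport_mul_subset_left).trans ?_
      rw [η.tsupport_eq]
      exact Metric.closedBall_subset_ball (show (ρ + r) / 2 < r by linarith)
    have hζφ : ContDiff ℝ ∞ fun x => (1 - η x) * φ x := (contDiff_const.sub η.contDiff).mul hφ
    have hζφc : HasCompactSupport fun x => (1 - η x) * φ x := hc.mul_left
    have h1 := hball _ ⟨hηφ, hηφc, hηφs⟩ fun x => mul_nonneg η.nonneg (h0 x)
    have h2 := hglobal _ ⟨hζφ, hζφc, Set.subset_univ _⟩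
      fun x => mul_nonneg (sub_nonneg.2 η.le_one) (h0 x)
    simp only [← inner_pField_gradient, zero_mul, integral_zero, Measure.restrict_univ] at h1 h2
    have hout : ∀ x, x ∉ Metric.ball 0 r →
        inner ℝ (pField p (gradient u x)) (gradient (fun x => η x * φ x) x) = 0 := fun x hx => by
      rw [gradient_eq_zero_of_notMem_tsupport fun h => hx (hηφs h), inner_zero_right]
    rw [setIntegral_eq_integral_of_forall_compl_eq_zero hout, integral_const_mul] at h1
    have hsum : ∫ x, inner ℝ (pField p (gradient u x)) (gradient φ x) =
        (∫ x, inner ℝ (pField p (gradient u x)) (gradient (fun x => η x * φ x) x)) +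
        ∫ x, inner ℝ (pField p (gradient u x)) (gradient (fun x => (1 - η x) * φ x) x) := by
      rw [← integral_add (integrable_inner_gradient hF (hηφ.of_le hle) hηφc)
        (integrable_inner_gradient hF (hζφ.of_le hle) hζφc)]
      congr 1
      ext x
      have hg := ((hηφ.differentiable (by simp) x).hasGradientAt.hasFDerivAt.add
        (hζφ.differentiable (by simp) x).hasGradientAt.hasFDerivAt)
      rw [← map_add] at hg
      rw [← inner_add_right, ← HasGradientAt.gradient hg]
      congr 2
      ext y
      simp only [Pi.add_apply]
      ring
    have hmono : ∫ x in Metric.closedBall 0 ρ, φ x ≤ ∫ x in Metric.ball 0 r, η x * φ x := by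
      rw [setIntegral_congr_fun (g := fun x => η x * φ x) Metric.isClosed_closedBall.measurableSet
        fun x hx => by simp only [η.one_of_mem_closedBall hx, one_mul]]
      exact setIntegral_mono_set
        (hηφ.continuous.integrable_of_hasCompactSupport hηφc).integrableOn
        (Filter.Eventually.of_forall fun x => mul_nonneg η.nonneg (h0 x))
        (Filter.Eventually.of_forall (Metric.closedBall_subset_ball hρr))
    have := mul_le_mul_of_nonneg_left hmono hA
    linarith
  -- Let `ρ ↑ r`; the shift `n + 2` keeps the radius positive already at `n = 0`.
  have hlim : Filter.Tendsto
      (fun n : ℕ => A * ∫ x in Metric.closedBall 0 (r * (1 - 1 / ((n : ℝ) + 2))), φ x)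
      Filter.atTop (nhds (A * ∫ x in Metric.ball 0 r, φ x)) := by
    have hU : ⋃ n : ℕ, Metric.closedBall (0 : EuclideanSpace ℝ (Fin N))
        (r * (1 - 1 / ((n : ℝ) + 2))) = Metric.ball 0 r := by
      ext x
      simp only [Set.mem_iUnion, mem_closedBall_zero_iff, mem_ball_zero_iff]
      constructor
      · rintro ⟨n, hn⟩
        have : 0 < 1 / ((n : ℝ) + 2) := by positivity
        nlinarith
      · intro hx
        obtain ⟨n, hn⟩ := exists_nat_one_div_lt (show 0 < (r - ‖x‖) / r from
          div_pos (by linarith) hr)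
        refine ⟨n, ?_⟩
        have h1 : 1 / ((n : ℝ) + 2) ≤ 1 / ((n : ℝ) + 1) :=
          one_div_le_one_div_of_le (by positivity) (by linarith)
        rw [lt_div_iff₀ hr] at hn
        nlinarith
    rw [← hU]
    refine (tendsto_setIntegral_of_monotone
      (fun n => Metric.isClosed_closedBall.measurableSet) (fun m n hmn => ?_)
      hφi.integrableOn).const_mul A
    refine Metric.closedBall_subset_closedBall ?_
    have h1 : 1 / ((n : ℝ) + 2) ≤ 1 / ((m : ℝ) + 2) :=
      one_div_le_one_div_of_le (by positivity) (by gcongr)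
    gcongr
  refine le_of_tendsto' hlim fun n => ?_
  have h1 : 1 / ((n : ℝ) + 2) < 1 := by
    rw [div_lt_one (by positivity)]
    have : (0 : ℝ) ≤ n := n.cast_nonneg
    linarith
  have h2 : 0 < 1 / ((n : ℝ) + 2) := by positivity
  exact key _ (mul_pos hr (by linarith)) (by nlinarith)

end Gluing

/-! ### Polar coordinates and the divergence of the truncated radial field. -/

section Polar

variable {E : Type*} [NormedAddCommGroup E] [NormedSpace ℝ E] [FiniteDimensional ℝ E]
  [MeasurableSpace E] [BorelSpace E] [Nontrivial E] (μ : Measure E) [μ.IsAddHaarMeasure]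

/-- Polar coordinates: a function whose weighted integral along every ray from the origin vanishes
has vanishing integral. -/
theorem integral_eq_zero_of_integral_ray_eq_zero {f : E → ℝ} (hf : Integrable f μ)
    (h : ∀ θ : E, ‖θ‖ = 1 →
      ∫ s in Set.Ioi (0 : ℝ), s ^ (Module.finrank ℝ E - 1) * f (s • θ) = 0) :
    ∫ x, f x ∂μ = 0 := by
  let g : Metric.sphere (0 : E) 1 × Set.Ioi (0 : ℝ) → ℝ := fun z => f (z.2.1 • z.1.1)
  have hmp := μ.measurePreserving_homeomorphUnitSphereProd
  have hemb := (homeomorphUnitSphereProd E).measurableEmbedding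
  have hcomp : ∀ x : ({0}ᶜ : Set E), g (homeomorphUnitSphereProd E x) = f x := fun x => by
    have := congrArg Subtype.val ((homeomorphUnitSphereProd E).symm_apply_apply x)
    rw [homeomorphUnitSphereProd_symm_apply_coe] at this
    exact congrArg f this
  have hfi : Integrable (fun x : ({0}ᶜ : Set E) => f x) (μ.comap (↑)) :=
    (integrableOn_iff_comap_subtypeVal (measurableSet_singleton _).compl).1 hf.integrableOn
  have hgi : Integrable g (μ.toSphere.prod (Measure.volumeIoiPow (Module.finrank ℝ E - 1))) := by
    rw [← hmp.integrable_comp_emb hemb]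
    exact hfi.congr (Filter.Eventually.of_forall fun x => (hcomp x).symm)
  calc ∫ x, f x ∂μ = ∫ x : ({0}ᶜ : Set E), f x ∂(μ.comap (↑)) := by
        rw [integral_subtype_comap (measurableSet_singleton _).compl f, restrict_compl_singleton]
    _ = ∫ z, g z ∂(μ.toSphere.prod (Measure.volumeIoiPow (Module.finrank ℝ E - 1))) := by
        rw [← hmp.integral_comp hemb]
        simp only [hcomp]
    _ = ∫ θ, ∫ s, g (θ, s) ∂(Measure.volumeIoiPow (Module.finrank ℝ E - 1)) ∂μ.toSphere :=
        integral_prod _ hgi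
    _ = 0 := by
        refine integral_eq_zero_of_ae (Filter.Eventually.of_forall fun θ => ?_)
        simp only [Measure.volumeIoiPow, ENNReal.ofReal, Pi.zero_apply]
        rw [integral_withDensity_eq_integral_smul
            ((measurable_subtype_coe.pow_const _).real_toNNReal),
          integral_subtype_comap measurableSet_Ioi fun a : ℝ =>
            Real.toNNReal (a ^ (Module.finrank ℝ E - 1)) • f (a • θ.1)]
        refine Eq.trans (setIntegral_congr_fun measurableSet_Ioi fun x hx => ?_)
          (h θ.1 (by simp))
        rw [NNReal.smul_def, Real.coe_toNNReal _ (pow_nonneg (le_of_lt (Set.mem_Ioi.1 hx)) _), smul_eq_mul]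

/-- The field `(r / max |x| r)^n x`, with `n` the dimension, has distributional divergence
`n 1_{|x| < r}`. -/
theorem integral_fderiv_truncated_radial {r : ℝ} (hr : 0 < r) {φ : E → ℝ} (hφ : ContDiff ℝ 1 φ)
    (hc : HasCompactSupport φ) :
    ∫ x, (r / max ‖x‖ r) ^ Module.finrank ℝ E * fderiv ℝ φ x x ∂μ =
      -(Module.finrank ℝ E * ∫ x in Metric.ball 0 r, φ x ∂μ) := by
  set n := Module.finrank ℝ E with hn
  have hn0 : n ≠ 0 := (Module.finrank_pos).ne'
  have hi1 : Integrable (fun x => (r / max ‖x‖ r) ^ n * fderiv ℝ φ x x) μ := by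
    have hcont : Continuous fun x => (r / max ‖x‖ r) ^ n * fderiv ℝ φ x x := by
      refine Continuous.mul (Continuous.pow (continuous_const.div (by fun_prop) fun x => ?_) _)
        ((hφ.continuous_fderiv one_ne_zero).clm_apply continuous_id)
      exact (lt_max_of_lt_right hr).ne'
    refine hcont.integrable_of_hasCompactSupport (HasCompactSupport.intro hc fun x hx => ?_)
    have : fderiv ℝ φ x = 0 := by
      by_contra h
      exact hx (support_fderiv_subset ℝ h)
    simp [this]
  have hi2 : Integrable ((Metric.ball 0 r).indicator fun x => n * φ x) μ :=
    (integrable_indicator_iff measurableSet_ball).2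
      ((hφ.continuous.integrable_of_hasCompactSupport hc).const_mul _).integrableOn
  have hz := integral_eq_zero_of_integral_ray_eq_zero μ (hi1.add hi2) fun θ hθ => by
    let f : ℝ → ℝ := fun s => φ (s • θ)
    have hsm : ContDiff ℝ 1 fun s : ℝ => s • θ := contDiff_id.smul contDiff_const
    have hf : ContDiff ℝ 1 f := hφ.comp hsm
    have hfc : HasCompactSupport f := by
      obtain ⟨R, hR⟩ := hc.isCompact.isBounded.subset_closedBall 0
      refine HasCompactSupport.intro (isCompact_closedBall (0 : ℝ) R) fun s hs => ?_
      by_contra h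
      have := hR (subset_tsupport _ h)
      rw [mem_closedBall_zero_iff, norm_smul, hθ, mul_one] at this
      exact hs (by simpa using this)
    have hf' : ∀ s, HasDerivAt f (fderiv ℝ φ (s • θ) θ) s := fun s => by
      have h1 := (hφ.differentiable one_ne_zero (s • θ)).hasFDerivAt
      have h2 : HasDerivAt (fun s : ℝ => s • θ) θ s := by
        simpa using (hasDerivAt_id s).smul_const θ
      exact h1.comp_hasDerivAt s h2
    have hg : ContDiff ℝ 1 fun s => s ^ n * f s := (contDiff_id.pow n).mul hf
    have hgc : HasCompactSupport fun s => s ^ n * f s := hfc.mul_left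
    have hk : ContDiff ℝ 1 fun s => (s ^ n - r ^ n) * f s :=
      ((contDiff_id.pow n).sub contDiff_const).mul hf
    have hkc : HasCompactSupport fun s => (s ^ n - r ^ n) * f s := hfc.mul_left
    have hg' : ∀ s, deriv (fun s => s ^ n * f s) s =
        n * s ^ (n - 1) * f s + s ^ n * fderiv ℝ φ (s • θ) θ := fun s =>
      ((hasDerivAt_pow n s).mul (hf' s)).deriv
    have hk' : ∀ s, deriv (fun s => (s ^ n - r ^ n) * f s) s =
        n * s ^ (n - 1) * f s + (s ^ n - r ^ n) * fderiv ℝ φ (s • θ) θ := fun s =>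
      (((hasDerivAt_pow n s).sub_const _).mul (hf' s)).deriv
    have hgi : Integrable (deriv fun s => s ^ n * f s) :=
      (hg.continuous_deriv le_rfl).integrable_of_hasCompactSupport hgc.deriv
    have hki : Integrable (deriv fun s => (s ^ n - r ^ n) * f s) :=
      (hk.continuous_deriv le_rfl).integrable_of_hasCompactSupport hkc.deriv
    have hI1 := hgc.integral_Ioi_deriv_eq hg 0
    have hI2 := hkc.integral_Ioi_deriv_eq hk r
    rw [← integral_Ici_eq_integral_Ioi] at hI2
    -- On a ray the integrand is `(s^n f)'` for `s < r` and `n s^(n-1) f` is absent beyond, leaving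
    -- `r^n f' = (s^n f)' - ((s^n - r^n) f)'`. Both boundary terms vanish, at `0` and at `r`.
    have hIr : ∫ s in Set.Ioi (0 : ℝ),
        (Set.Ici r).indicator (deriv fun s => (s ^ n - r ^ n) * f s) s = 0 := by
      rw [setIntegral_indicator measurableSet_Ici, Set.inter_eq_right.2 (Set.Ici_subset_Ioi.2 hr),
        hI2]
      simp
    have hsub := integral_sub hgi.integrableOn
      (hki.indicator (measurableSet_Ici (a := r))).integrableOn (μ := volume.restrict (Set.Ioi 0))
    rw [hI1, hIr, zero_pow hn0, zero_mul, neg_zero, sub_zero] at hsub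
    refine Eq.trans (setIntegral_congr_fun measurableSet_Ioi fun s (hs : 0 < s) => ?_) hsub
    have hnorm : ‖s • θ‖ = s := by rw [norm_smul, hθ, mul_one, Real.norm_of_nonneg hs.le]
    have hpow : s ^ n = s ^ (n - 1) * s := (pow_sub_one_mul hn0 s).symm
    simp only [Pi.add_apply, hnorm, map_smul, smul_eq_mul, hg', f]
    rcases lt_or_ge s r with hsr | hsr
    · rw [Set.indicator_of_mem (by simpa [hnorm] using hsr),
        Set.indicator_of_notMem (by simpa using hsr), max_eq_right hsr.le, div_self hr.ne', hpow]
      ring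
    · rw [Set.indicator_of_notMem (by simpa [hnorm] using hsr),
        Set.indicator_of_mem (by simpa using hsr), hk', max_eq_left hsr, div_pow, hpow]
      have : s ^ (n - 1) ≠ 0 := by positivity
      field_simp
      ring
  rw [integral_add' hi1 hi2, integral_indicator measurableSet_ball, integral_const_mul] at hz
  linarith

end Polar

/-! ### Regularity of radial functions. -/

section RadialFunction

variable {E : Type*} [NormedAddCommGroup E] [InnerProductSpace ℝ E] [CompleteSpace E]

/-- Away from the origin this is the chain rule; at the origin `V' 0 = 0` gives `V ‖y‖ - V 0 =
o(‖y‖)`, although the norm is not differentiable there. -/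
theorem hasGradientAt_radial {V V' : ℝ → ℝ} (hV : ∀ s, HasDerivAt V (V' s) s) (h0 : V' 0 = 0)
    (x : E) : HasGradientAt (fun y : E => V ‖y‖) ((V' ‖x‖ / ‖x‖) • x) x := by
  rcases eq_or_ne x 0 with rfl | hx
  · rw [smul_zero, hasGradientAt_iff_isLittleO]
    have h := (hasDerivAt_iff_isLittleO.1 (hV 0)).comp_tendsto
      (show Filter.Tendsto (fun y : E => ‖y‖) (nhds 0) (nhds 0) by
        simpa using (continuous_norm (E := E)).tendsto 0)
    refine Asymptotics.IsLittleO.of_norm_right ?_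
    simpa [Function.comp_def, h0] using h
  · have hn : HasGradientAt (fun y : E => ‖y‖) ((1 / ‖x‖) • x) x := by
      rw [hasGradientAt_iff_hasFDerivAt]
      have h1 : HasFDerivAt (fun y : E => ‖y‖ ^ 2) (2 • innerSL ℝ x) x :=
        (hasStrictFDerivAt_norm_sq x).hasFDerivAt
      have h2 := h1.sqrt (by simpa using hx)
      simp only [Real.sqrt_sq (norm_nonneg _)] at h2
      convert! h2 using 1
      ext y
      simp
      ring
    rw [hasGradientAt_iff_hasFDerivAt] at hn ⊢
    convert! (hV ‖x‖).comp_hasFDerivAt x hn using 1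
    ext y
    simp
    ring

theorem contDiff_one_of_hasGradientAt {f : E → ℝ} {G : E → E} (h : ∀ x, HasGradientAt f (G x) x)
    (hG : Continuous G) : ContDiff ℝ 1 f := by
  rw [contDiff_one_iff_hasFDerivAt]
  exact ⟨_, (InnerProductSpace.toDual ℝ E).continuous.comp hG, h⟩

theorem contDiff_radial {V V' : ℝ → ℝ} (hV : ∀ s, HasDerivAt V (V' s) s) (h0 : V' 0 = 0)
    (hc : Continuous V') : ContDiff ℝ 1 fun x : E => V ‖x‖ := by
  refine contDiff_one_of_hasGradientAt (hasGradientAt_radial hV h0) ?_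
  rw [continuous_iff_continuousAt]
  intro x
  rcases eq_or_ne x 0 with rfl | hx
  · rw [ContinuousAt, smul_zero, tendsto_zero_iff_norm_tendsto_zero]
    have h : Filter.Tendsto (fun y : E => |V' ‖y‖|) (nhds 0) (nhds 0) := by
      have := (hc.comp (continuous_norm (E := E))).abs.tendsto 0
      simpa [h0] using this
    refine squeeze_zero (fun _ => norm_nonneg _) (fun y => ?_) h
    rw [norm_smul, norm_div, norm_norm, Real.norm_eq_abs]
    rcases eq_or_ne ‖y‖ 0 with hy | hy
    · simp [hy]
    · rw [div_mul_cancel₀ _ hy]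
  · exact ((hc.comp continuous_norm).continuousAt.div continuous_norm.continuousAt
      (by simpa using hx)).smul continuousAt_id

end RadialFunction

/-! ### The comparison principle. -/

section Comparison

theorem hasDerivAt_sq_max_zero (t : ℝ) :
    HasDerivAt (fun t : ℝ => max t 0 ^ 2) (2 * max t 0) t := by
  rcases lt_trichotomy t 0 with ht | rfl | ht
  · rw [max_eq_right ht.le, mul_zero]
    refine (hasDerivAt_const t (0 : ℝ)).congr_of_eventuallyEq ?_
    filter_upwards [gt_mem_nhds ht] with s hs
    simp [max_eq_right (le_of_lt hs)]
  · rw [hasDerivAt_iff_isLittleO]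
    have h : (fun t : ℝ => max t 0 ^ 2) =O[nhds 0] fun t => t ^ 2 := by
      refine Asymptotics.IsBigO.of_bound 1 (Filter.Eventually.of_forall fun t => ?_)
      rw [one_mul, norm_pow, norm_pow]
      gcongr
      rcases le_total t 0 with h | h <;> simp [h]
    simpa using h.trans_isLittleO (Asymptotics.isLittleO_pow_id one_lt_two)
  · rw [max_eq_left ht.le]
    have h := hasDerivAt_pow 2 t
    norm_num at h
    refine h.congr_of_eventuallyEq ?_
    filter_upwards [lt_mem_nhds ht] with s hs
    rw [max_eq_left (le_of_lt hs)]

variable {E : Type*} [NormedAddCommGroup E] [InnerProductSpace ℝ E] [FiniteDimensional ℝ E]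
  [Nontrivial E] [MeasurableSpace E] [BorelSpace E]

/-- Weak comparison principle for the `p`-Laplacian on the whole space. -/
theorem le_of_weak_pLaplacian_le (μ : Measure E) [μ.IsAddHaarMeasure] {p : ℝ} (hp : 1 < p)
    {u v : E → ℝ} (hu : ContDiff ℝ 1 u) (hv : ContDiff ℝ 1 v)
    (hfar : ∀ ε, 0 < ε → ∃ R, ∀ x, R < ‖x‖ → v x ≤ u x + ε)
    (h : ∀ φ : E → ℝ, ContDiff ℝ 1 φ → HasCompactSupport φ → (∀ x, 0 ≤ φ x) →
      ∫ x, inner ℝ (pField p (gradient v x)) (gradient φ x) ∂μ ≤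
        ∫ x, inner ℝ (pField p (gradient u x)) (gradient φ x) ∂μ) (x : E) :
    v x ≤ u x := by
  refine le_of_forall_pos_le_add fun ε hε => ?_
  obtain ⟨R, hR⟩ := hfar ε hε
  let w : E → ℝ := fun x => v x - u x - ε
  let φ : E → ℝ := fun x => max (w x) 0 ^ 2
  have hw : ContDiff ℝ 1 w := (hv.sub hu).sub contDiff_const
  have hgrad : ∀ x, HasGradientAt φ ((2 * max (w x) 0) • (gradient v x - gradient u x)) x := by
    intro x
    have h1 := (((hv.differentiable one_ne_zero x).hasGradientAt.hasFDerivAt).sub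
      ((hu.differentiable one_ne_zero x).hasGradientAt.hasFDerivAt)).sub_const ε
    have h2 := (hasDerivAt_sq_max_zero (w x)).comp_hasFDerivAt x h1
    rw [hasGradientAt_iff_hasFDerivAt]
    convert! h2 using 1
    ext y
    simp
  have hφ : ContDiff ℝ 1 φ := contDiff_one_of_hasGradientAt hgrad
    ((continuous_const.mul (hw.continuous.max continuous_const)).smul
      (hv.continuous_gradient.sub hu.continuous_gradient))
  have hφ0 : ∀ x, R < ‖x‖ → φ x = 0 := fun x hx => by
    have : w x ≤ 0 := by
      have := hR x hx
      simp only [w]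
      linarith
    simp [φ, max_eq_right this]
  have hc : HasCompactSupport φ :=
    HasCompactSupport.intro (isCompact_closedBall (0 : E) R) fun x hx => hφ0 x (by simpa using hx)
  have hFu : Continuous fun x => pField p (gradient u x) :=
    (continuous_pField hp).comp hu.continuous_gradient
  have hFv : Continuous fun x => pField p (gradient v x) :=
    (continuous_pField hp).comp hv.continuous_gradient
  let D : E → ℝ := fun x =>
    inner ℝ (pField p (gradient v x) - pField p (gradient u x)) (gradient φ x)
  have hDexp : ∀ x, D x = 2 * max (w x) 0 *
      inner ℝ (pField p (gradient v x) - pField p (gradient u x))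
        (gradient v x - gradient u x) := fun x => by
    simp only [D, (hgrad x).gradient, real_inner_smul_right]
  have hD0 : ∀ x, 0 ≤ D x := fun x => by
    rw [hDexp]
    refine mul_nonneg (by positivity) ?_
    by_cases hx : gradient v x = gradient u x
    · simp [hx]
    · exact (inner_pField_sub_pos hp hx).le
  have hDint : ∫ x, D x ∂μ ≤ 0 := by
    simp only [D, inner_sub_left]
    rw [integral_sub (integrable_inner_gradient hFv hφ hc) (integrable_inner_gradient hFu hφ hc)]
    linarith [h φ hφ hc fun x => sq_nonneg _]
  have hDcont : Continuous D := (hFv.sub hFu).inner hφ.continuous_gradient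
  have hDc : HasCompactSupport D := HasCompactSupport.intro hc fun x hx => by
    simp only [D, gradient_eq_zero_of_notMem_tsupport hx, inner_zero_right]
  -- A continuous nonnegative function with nonpositive integral vanishes identically.
  have hDz : ∀ x, D x = 0 := by
    intro x
    by_contra hx
    exact (hDcont.integral_pos_of_hasCompactSupport_nonneg_nonzero hDc hD0 hx).not_ge hDint
  have hφ' : ∀ x, fderiv ℝ φ x = 0 := by
    intro x
    rw [(hgrad x).hasFDerivAt.fderiv]
    have hx := hDz x
    rw [hDexp] at hx
    rcases mul_eq_zero.1 hx with hx | hx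
    · simp [hx]
    · have : gradient v x = gradient u x := by
        by_contra hne
        exact (inner_pField_sub_pos hp hne).ne' hx
      simp [this]
  -- `φ` is constant, so one point outside the support determines it.
  obtain ⟨y, hy⟩ := NormedSpace.exists_lt_norm ℝ E R
  have hx : φ x = 0 := by
    rw [is_const_of_fderiv_eq_zero (hφ.differentiable one_ne_zero) hφ' x y, hφ0 y hy]
  have : w x ≤ 0 := max_eq_right_iff.1 (pow_eq_zero_iff two_ne_zero |>.1 hx)
  simp only [w] at this
  linarith

end Comparison

/-! ### The explicit barrier and the conclusion. -/

section Barrier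

/-- The radial solution of `-Δ_p v = A 1_{|x| < r}` that vanishes at infinity. -/
theorem exists_radial_barrier {N : ℕ} {p A r : ℝ} (hp : 1 < p) (hpN : p < N) (hA : 0 < A)
    (hr : 0 < r) :
    ∃ v : EuclideanSpace ℝ (Fin N) → ℝ, ContDiff ℝ 1 v ∧
      (∀ x, pField p (gradient v x) = -((A / N * (r / max ‖x‖ r) ^ N) • x)) ∧
      ∀ x, r ≤ ‖x‖ → v x = ((A / N) ^ (1 / (p - 1)) * ((p - 1) / (N - p)) *
        r ^ ((N : ℝ) / (p - 1))) * ‖x‖ ^ ((p - N) / (p - 1)) := by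
  have hN : (0 : ℝ) < N := by linarith
  have hp1 : 0 < p - 1 := by linarith
  have hNp : 0 < N - p := by linarith
  set a := A / N with ha_def
  have ha : 0 < a := div_pos hA hN
  -- The slope `-V'`, found by solving `k ^ (p - 1) = a s (r / max s r) ^ N`, the prescribed radial
  -- flux, for `s ≥ 0`.
  let k : ℝ → ℝ := fun s => (a * (s * (r / max s r) ^ N)) ^ (1 / (p - 1))
  have hq : 0 < 1 / (p - 1) := by positivity
  have hmax : ∀ s, 0 < max s r := fun s => lt_max_of_lt_right hr
  have hk : Continuous k := by
    refine Continuous.rpow_const ?_ fun _ => Or.inr hq.le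
    exact continuous_const.mul (continuous_id.mul ((continuous_const.div (by fun_prop)
      fun s => (hmax s).ne').pow N))
  have hk0 : k 0 = 0 := by simp [k, Real.zero_rpow hq.ne', -one_div]
  set c := a ^ (1 / (p - 1)) * ((p - 1) / (N - p)) * r ^ ((N : ℝ) / (p - 1)) with hc
  set β := (p - N) / (p - 1) with hβ
  have hβ0 : β ≠ 0 := (div_neg_of_neg_of_pos (by linarith) hp1).ne
  -- The constant is chosen so that `V s = c * s ^ β` for `s ≥ r`, with no additive remainder.
  let V : ℝ → ℝ := fun s => c * r ^ β - ∫ t in r..s, k t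
  have hV : ∀ s, HasDerivAt V (-k s) s := fun s => by
    simpa using (hk.integral_hasStrictDerivAt r s).hasDerivAt.const_sub (c * r ^ β)
  refine ⟨fun x => V ‖x‖, contDiff_radial hV (by simp [hk0]) hk.neg, fun x => ?_, fun x hx => ?_⟩
  · rw [(hasGradientAt_radial hV (by simp [hk0]) x).gradient]
    rcases eq_or_ne x 0 with rfl | hx
    · simp [pField]
    · have hx : 0 < ‖x‖ := norm_pos_iff.2 hx
      have hb : 0 < a * (‖x‖ * (r / max ‖x‖ r) ^ N) := by
        have := hmax ‖x‖
        positivity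
      have hkx : 0 < k ‖x‖ := Real.rpow_pos_of_pos hb _
      have hkp : k ‖x‖ ^ (p - 1) = a * (‖x‖ * (r / max ‖x‖ r) ^ N) := by
        simp only [k]
        rw [← Real.rpow_mul hb.le, one_div_mul_cancel hp1.ne', Real.rpow_one]
      have hn : ‖(-k ‖x‖ / ‖x‖) • x‖ = k ‖x‖ := by
        rw [norm_smul, norm_div, norm_neg, norm_norm, div_mul_cancel₀ _ hx.ne',
          Real.norm_of_nonneg hkx.le]
      rw [pField, hn, smul_smul, ← neg_smul]
      congr 1
      rw [neg_div, mul_neg, ← mul_div_assoc, rpow_sub_two_mul_self hp hkx.le, hkp]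
      field_simp
  · have hx0 : 0 < ‖x‖ := hr.trans_le hx
    have hint : ∫ t in r..‖x‖, k t = ∫ t in r..‖x‖,
        (a ^ (1 / (p - 1)) * r ^ ((N : ℝ) / (p - 1))) * t ^ (β - 1) := by
      refine intervalIntegral.integral_congr fun t ht => ?_
      rw [Set.uIcc_of_le hx] at ht
      have ht0 : 0 < t := hr.trans_le ht.1
      have h1 : t * (r / max t r) ^ N = r ^ (N : ℝ) * t ^ (1 - (N : ℝ)) := by
        rw [max_eq_left ht.1, Real.rpow_sub ht0, Real.rpow_one, Real.rpow_natCast,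
          Real.rpow_natCast, div_pow]
        ring
      simp only [k]
      rw [h1, Real.mul_rpow ha.le (by positivity), Real.mul_rpow (by positivity) (by positivity),
        ← Real.rpow_mul hr.le, ← Real.rpow_mul ht0.le, mul_one_div, mul_one_div, mul_assoc]
      congr 3
      rw [hβ]
      field_simp
      ring
    have h0 : (0 : ℝ) ∉ Set.uIcc r ‖x‖ := by
      rw [Set.uIcc_of_le hx]
      exact fun h => absurd h.1 (not_le.2 hr)
    have hcβ : a ^ (1 / (p - 1)) * r ^ ((N : ℝ) / (p - 1)) = -(c * β) := by
      rw [hc, hβ]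
      field_simp
      ring
    simp only [V]
    rw [hint, intervalIntegral.integral_const_mul,
      integral_rpow (Or.inr ⟨by simpa [sub_eq_iff_eq_add] using hβ0, h0⟩), sub_add_cancel, hcβ]
    field_simp
    ring

end Barrier

theorem proposition5p2 (N : ℕ) (p : ℝ) (hp : 1 < p) (hpN : p < N)
    (A r : ℝ) (hA : 0 < A) (hr : 0 < r) (α : ℝ≥0) (hα : 0 < α)
    (u : EuclideanSpace ℝ (Fin N) → ℝ)
    (huD : MemD1p p u) (huC : MemC1HolderLoc α u)
    (hball : WeakNegPLaplacianGE p (Metric.ball 0 r) u A)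
    (hglobal : WeakNegPLaplacianGE p Set.univ u 0)
    (hnonneg : ∀ x, 0 ≤ u x) :
    ∀ x : EuclideanSpace ℝ (Fin N), r < ‖x‖ →
      ((A / N) ^ (1 / (p - 1)) * ((p - 1) / (N - p)) * r ^ ((N : ℝ) / (p - 1))) *
        ‖x‖ ^ ((p - N) / (p - 1)) ≤ u x := by
  have hN : (0 : ℝ) < N := by linarith
  have : Nontrivial (EuclideanSpace ℝ (Fin N)) :=
    Module.nontrivial_of_finrank_pos (R := ℝ) (by simpa using hN)
  obtain ⟨v, hv, hvF, hvout⟩ := exists_radial_barrier hp hpN hA hr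
  have hu := huC.1
  have hFu : Continuous fun x => pField p (gradient u x) :=
    (continuous_pField hp).comp hu.continuous_gradient
  intro x hx
  rw [← hvout x hx.le]
  refine le_of_weak_pLaplacian_le volume hp hu hv (fun ε hε => ?_) (fun φ hφ hc h0 => ?_) x
  · set c := (A / N) ^ (1 / (p - 1)) * ((p - 1) / (N - p)) * r ^ ((N : ℝ) / (p - 1))
    have hlim : Filter.Tendsto (fun s : ℝ => c * s ^ ((p - N) / (p - 1))) Filter.atTop (nhds 0) := by
      have h := (tendsto_rpow_neg_atTop (show 0 < (N - p) / (p - 1) from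
        div_pos (by linarith) (by linarith))).const_mul c
      rw [mul_zero] at h
      convert h using 4
      ring
    obtain ⟨R, hR⟩ := Filter.eventually_atTop.1 (hlim.eventually (gt_mem_nhds hε))
    refine ⟨max R r, fun y hy => ?_⟩
    rw [hvout y ((le_max_right _ _).trans hy.le)]
    linarith [hR ‖y‖ ((le_max_left _ _).trans hy.le), hnonneg y]
  · refine le_trans (le_of_eq ?_) (weak_ineq_of_smooth hFu hA.le
      (fun ψ hψ hψc hψ0 => weakNegPLaplacianGE_glue hp hA.le hr hu hball hglobal hψ hψc hψ0)
      hφ hc h0)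
    have h1 := integral_fderiv_truncated_radial volume hr hφ hc
    rw [finrank_euclideanSpace_fin] at h1
    -- The dimension factor in the divergence identity cancels the `N` of `A / N`.
    calc _ = ∫ x, -(A / N) * ((r / max ‖x‖ r) ^ N * fderiv ℝ φ x x) := by
          congr 1
          ext x
          rw [hvF, inner_neg_left, real_inner_smul_left, real_inner_comm, inner_gradient]
          ring
      _ = _ := by
          rw [integral_const_mul, h1]
          field_simp
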